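/- **Setting.** A map $G:\mathbb{R}^k\to\mathbb{R}^n$ is computed by a $d$-layer ReLU network ($d\ge 1$) if it is a composition of $d-1$ hidden layers $x\mapsto \mathrm{ReLU}(Wx+\beta)$ followed by an output layer $x\mapsto Wx+\beta$ with or without the ReLU, where ReLU acts coordinatewise. Fix such a $G$, a point $z^*\in\mathbb{R}^k$, $\sigma\ge 0$ and $C>0$. Let $A\in\mathbb{R}^{m\times n}$ be a random matrix with rows $a_1,\dots,a_m$, let $\eta\in\mathbb{R}^m$ be random noise, and let $y=AG(z^*)+\eta$. Assume that the pairs $(a_i,\eta_i)$, $1\le i\le m$, are i.i.d.; that $\eta_i$ is independent of $a_i$; that $\mathbb{E}[\eta_i]=0$ and $\mathrm{Var}(\eta_i)\le\sigma^2$; and that each $a_i$ is isotropic ($\mathbb{E}\langle a_i,u\rangle^2=\|u\|^2$ for all $u\in\mathbb{R}^n$) and satisfies $(\mathbb{E}\langle a_i,u\rangle^4)^{1/4}\le C(\mathbb{E}\langle a_i,u\rangle^2)^{1/2}$ for all $u\in\mathbb{R}^n$. Let $[m]$ be partitioned into $M$ disjoint batches $B_1,\dots,B_M$ of $b\ge 1$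 elements each, so $m=Mb$, and let $A_{B_j}$, $\eta_{B_j}$ be the rows of $A$ and the entries of $\eta$ with index in $B_j$. **Lemma.** There are universal constants $b_0,c>0$ and, for every $p\in\mathbb{N}$, a constant $K=K(p)>0$ such that the following holds in the above setting whenever every hidden layer of $G$ has at most $n^p$ nodes and $M\ge K\,kd\log n$ (with the convention $\log 0=0$). 1. For every $t>0$ with $b\ge b_0\,\sigma^2/t^2$, with probability at least $1-e^{-(c/b)m}$, for all $z\in\mathbb{R}^k$ there is a set $J\subseteq[M]$ with $|J|\ge 0.9M$ such that $$\frac1b\left|\eta_{B_j}^{\top}A_{B_j}\bigl(G(z)-G(z^*)\bigr)\right|\le t\,\|G(z)-G(z^*)\|\qquad\text{for all } j\in J.$$ 2. If $b\ge b_0$, then with probability at least $1-e^{-(c/b)m}$, for all $z\in\mathbb{R}^k$ there is a set $J\subseteq[M]$ with $|J|\ge 0.9M$ such that $$\frac1b\left|\eta_{B_j}^{\top}A_{B_j}\bigl(G(z)-G(z^*)\bigr)\right|\le \sigma\,\|G(z)-G(z^*)\|\qquad\text{for all } j\in J.$$ -/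

import Mathlib

open MeasureTheory ProbabilityTheory
open scoped Matrix

namespace MultiplierLemma

/-- One affine layer `x ↦ W x + β`. -/
noncomputable def affineLayer {l l' : ℕ} (W : Matrix (Fin l') (Fin l) ℝ)
    (β : EuclideanSpace ℝ (Fin l')) (x : EuclideanSpace ℝ (Fin l)) :
    EuclideanSpace ℝ (Fin l') :=
  WithLp.toLp 2 (fun i => (W *ᵥ x.ofLp) i + β i)

/-- The coordinatewise ReLU activation `x ↦ max x 0`. -/
noncomputable def relu {l : ℕ} (x : EuclideanSpace ℝ (Fin l)) : EuclideanSpace ℝ (Fin l) :=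
  WithLp.toLp 2 (fun i => max (x i) 0)

/-- `IsReLUStack w k h l F`: the map `F : ℝᵏ → ℝˡ` is a composition of `h` layers
`x ↦ relu (W x + β)`, each of which has at most `w` nodes. -/
inductive IsReLUStack (w k : ℕ) :
    (h l : ℕ) → (EuclideanSpace ℝ (Fin k) → EuclideanSpace ℝ (Fin l)) → Prop
  | input : IsReLUStack w k 0 k id
  | layer {h l l' : ℕ} {F : EuclideanSpace ℝ (Fin k) → EuclideanSpace ℝ (Fin l)}
      (hF : IsReLUStack w k h l F) (hl' : l' ≤ w)
      (W : Matrix (Fin l') (Fin l) ℝ) (β : EuclideanSpace ℝ (Fin l')) :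
      IsReLUStack w k (h + 1) l' (fun z => relu (affineLayer W β (F z)))

/-- `IsReLUNetwork w d k n G`: the map `G : ℝᵏ → ℝⁿ` is computed by a feedforward ReLU network with
`d ≥ 1` layers, namely `d - 1` hidden ReLU layers with at most `w` nodes each, followed by an output
layer `ℝˡ → ℝⁿ`.  The output layer may or may not apply the activation. -/
def IsReLUNetwork (w d k n : ℕ)
    (G : EuclideanSpace ℝ (Fin k) → EuclideanSpace ℝ (Fin n)) : Prop :=
  ∃ (h l : ℕ) (F : EuclideanSpace ℝ (Fin k) → EuclideanSpace ℝ (Fin l))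
    (W : Matrix (Fin n) (Fin l) ℝ) (β : EuclideanSpace ℝ (Fin n)),
    d = h + 1 ∧ IsReLUStack w k h l F ∧
      (G = (fun z => relu (affineLayer W β (F z))) ∨ G = (fun z => affineLayer W β (F z)))

section Sampling

variable {Ω : Type*} [MeasurableSpace Ω] (μ : Measure Ω) {n m k : ℕ}

/-- The fourth moment condition `(𝔼⟨a,u⟩⁴)^(1/4) ≤ C (𝔼⟨a,u⟩²)^(1/2)` in every direction `u`. -/
def IsHeavyTailed (C : ℝ) (a : Ω → EuclideanSpace ℝ (Fin n)) : Prop :=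
  ∀ u : EuclideanSpace ℝ (Fin n),
    Integrable (fun ω => (inner ℝ (a ω) u) ^ 4) μ ∧
      (∫ ω, (inner ℝ (a ω) u) ^ 4 ∂μ) ^ (1 / 4 : ℝ) ≤
        C * (∫ ω, (inner ℝ (a ω) u) ^ 2 ∂μ) ^ (1 / 2 : ℝ)

/-- `𝔼[a aᵀ] = I`, written as `𝔼⟨a,u⟩² = ‖u‖²` for all `u`. -/
def IsIsotropic (a : Ω → EuclideanSpace ℝ (Fin n)) : Prop :=
  ∀ u : EuclideanSpace ℝ (Fin n),
    Integrable (fun ω => (inner ℝ (a ω) u) ^ 2) μ ∧ ∫ ω, (inner ℝ (a ω) u) ^ 2 ∂μ = ‖u‖ ^ 2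

/-- The `i`-th row of the measurement matrix, as a random vector of Euclidean space. -/
noncomputable def row (A : Ω → Matrix (Fin m) (Fin n) ℝ) (i : Fin m) (ω : Ω) :
    EuclideanSpace ℝ (Fin n) :=
  WithLp.toLp 2 (A ω i)

/-- Uncorrupted samples `y = A x + η`: the pairs (row `aᵢ`, noise `ηᵢ`) are i.i.d., `ηᵢ` is
independent of `aᵢ`, the rows are isotropic and heavy-tailed with moment constant `C`, and the noise
is centred with variance at most `σ²`. -/
structure IsUncorruptedSample (C σ : ℝ) (x : EuclideanSpace ℝ (Fin n))
    (A : Ω → Matrix (Fin m) (Fin n) ℝ) (η y : Ω → Fin m → ℝ) : Prop where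
  measurable_row : ∀ i, Measurable (row A i)
  measurable_noise : ∀ i, Measurable (fun ω => η ω i)
  iIndep : iIndepFun (fun i ω => (row A i ω, η ω i)) μ
  identDistrib : ∀ i j, IdentDistrib (fun ω => (row A i ω, η ω i)) (fun ω => (row A j ω, η ω j)) μ μ
  indep_noise : ∀ i, IndepFun (row A i) (fun ω => η ω i) μ
  isotropic : ∀ i, IsIsotropic μ (row A i)
  heavyTailed : ∀ i, IsHeavyTailed μ C (row A i)
  noise_memLp : ∀ i, MemLp (fun ω => η ω i) 2 μ
  noise_mean : ∀ i, ∫ ω, η ω i ∂μ = 0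
  noise_variance : ∀ i, variance (fun ω => η ω i) μ ≤ σ ^ 2
  measurement : ∀ ω, y ω = A ω *ᵥ x.ofLp + η ω

end Sampling

/-- The batches `B₁, …, B_M` partition `[m]` and each of them has `b` elements
(so that `m = M b`). -/
structure IsBatchPartition {m M : ℕ} (b : ℕ) (B : Fin M → Finset (Fin m)) : Prop where
  disjoint : Pairwise (fun i j => Disjoint (B i) (B j))
  cover : ∀ i, ∃ j, i ∈ B j
  card_eq : ∀ j, (B j).card = b

/-- The rows of `A` with index in the batch `S`. -/
def batchMatrix {m n : ℕ} (A : Matrix (Fin m) (Fin n) ℝ) (S : Finset (Fin m)) :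
    Matrix S (Fin n) ℝ :=
  A.submatrix (fun i : S => (i : Fin m)) id

/-- The multiplier term `η_Sᵀ A_S v` of the batch `S`. -/
def multiplier {m n : ℕ} (A : Matrix (Fin m) (Fin n) ℝ) (η : Fin m → ℝ) (S : Finset (Fin m))
    (v : EuclideanSpace ℝ (Fin n)) : ℝ :=
  (fun i : S => η i) ⬝ᵥ (batchMatrix A S *ᵥ v.ofLp)

/-- The event (for given `A`, `η`) that for every `z` at least `0.9 M` of the batches satisfy
`(1/b) |η_{B_j}ᵀ A_{B_j} (G z - G z*)| ≤ t ‖G z - G z*‖`. -/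
def MultiplierBound {k n m M : ℕ} (G : EuclideanSpace ℝ (Fin k) → EuclideanSpace ℝ (Fin n))
    (zstar : EuclideanSpace ℝ (Fin k)) (b : ℕ) (B : Fin M → Finset (Fin m)) (t : ℝ)
    (A : Matrix (Fin m) (Fin n) ℝ) (η : Fin m → ℝ) : Prop :=
  ∀ z : EuclideanSpace ℝ (Fin k), ∃ J : Finset (Fin M), (9 / 10 : ℝ) * M ≤ J.card ∧
    ∀ j ∈ J, (1 / (b : ℝ)) * |multiplier A η (B j) (G z - G zstar)| ≤ t * ‖G z - G zstar‖

end MultiplierLemma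

/-! The multiplier term of batch `j`, divided by `b`, is the pairing of `v` with `X j = batchMean b
(B j) A η`. The `X j` are independent because the batches are disjoint. Centred noise independent of
the rows makes variances add, so `⟨X j, v⟩` has second moment at most `(σ² / b) ‖v‖²`.

For one fixed direction, Chebyshev bounds the failure probability of a batch by `exp (-80)`. By
independence, more than `M / 20` batches fail together with probability at most `exp (-3 M)`
(`measureReal_card_gt_le`).

Uniformity in `z` comes from counting. A ReLU network is piecewise affine, and Sauer–Shelah bounds
the number of pieces. Hence all increments `G z - G zstar` lie in few subspaces of dimension at most
`k + 1`, and each unit sphere there has a net of mesh `1 / (2n)`. Since `𝔼‖X j‖² ≤ n σ² / b`, most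
batches satisfy `‖X j‖ ≤ n t`, so passing from the net to the sphere costs only `t / 2`. The number
of net points is absorbed by `exp (2 M)` once `M` dominates `k d log n`. -/

namespace MultiplierLemma

/-! ### Counting the affine pieces of a ReLU network. -/

section Regions

/-- More than `dim V` affine functions on `V` do not realise all sign patterns. -/
lemma exists_signPattern_not_realized {V κ : Type*} [AddCommGroup V] [Module ℝ V]
    [FiniteDimensional ℝ V] [Fintype κ] (hκ : Module.finrank ℝ V < Fintype.card κ)
    (ℓ : κ → (V →ᵃ[ℝ] ℝ)) : ∃ s : Set κ, ∀ z, {i | 0 < ℓ i z} ≠ s := by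
  -- The dual of `V` has dimension `finrank V`, so the linear parts satisfy a nontrivial relation;
  -- the same combination of the `ℓ i` is then constant.
  have hdep : ¬ LinearIndependent ℝ (fun i => (ℓ i).linear) := by
    intro h
    have := h.fintype_card_le_finrank
    rw [Module.finrank_linearMap, Module.finrank_self, mul_one] at this
    omega
  obtain ⟨c, hc, i₀, hi₀⟩ := Fintype.not_linearIndependent_iff.1 hdep
  have hconst : ∀ z, ∑ i, c i * ℓ i z = ∑ i, c i * ℓ i 0 := by
    intro z
    have h1 : ∀ i, ℓ i z = (ℓ i).linear z + ℓ i 0 := fun i => by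
      conv_lhs => rw [AffineMap.decomp (ℓ i)]
      rfl
    have h2 := LinearMap.congr_fun hc z
    simp only [LinearMap.sum_apply, LinearMap.smul_apply, smul_eq_mul,
      LinearMap.zero_apply] at h2
    simp_rw [fun i => h1 i, mul_add, Finset.sum_add_distrib, h2, zero_add]
  -- a nontrivial relation whose constant term has a strict sign is contradicted by its own signs
  have key : ∀ e : κ → ℝ, (∀ z, ∑ i, e i * ℓ i z = ∑ i, e i * ℓ i 0) →
      (∑ i, e i * ℓ i 0 < 0 ∨ ∑ i, e i * ℓ i 0 = 0 ∧ ∃ i, 0 < e i) →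
      ∃ s : Set κ, ∀ z, {i | 0 < ℓ i z} ≠ s := by
    intro e he hsign
    -- If `ℓ i z` is positive exactly where `e i` is, every product `e i * ℓ i z` is nonnegative,
    -- and positive when `e i > 0`. The sum then cannot equal its prescribed constant value.
    refine ⟨{i | 0 < e i}, fun z hz => ?_⟩
    have hmem : ∀ i, 0 < ℓ i z ↔ 0 < e i := fun i => Set.ext_iff.1 hz i
    have hnn : ∀ i, 0 ≤ e i * ℓ i z := fun i => by
      by_cases h : 0 < e i
      · exact mul_nonneg h.le ((hmem i).2 h).le
      · exact mul_nonneg_of_nonpos_of_nonpos (not_lt.1 h) (not_lt.1 (mt (hmem i).1 h))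
    have hsum : 0 ≤ ∑ i, e i * ℓ i z := Finset.sum_nonneg fun i _ => hnn i
    rcases hsign with h | ⟨h, j, hj⟩
    · rw [he z] at hsum; linarith
    · have : 0 < ∑ i, e i * ℓ i z :=
        Finset.sum_pos' (fun i _ => hnn i) ⟨j, Finset.mem_univ _, mul_pos hj ((hmem j).2 hj)⟩
      rw [he z] at this; linarith
  have hneg : ∀ z, ∑ i, (-c) i * ℓ i z = ∑ i, (-c) i * ℓ i 0 := by
    intro z; simpa using hconst z
  have hneg0 : ∑ i, (-c) i * ℓ i 0 = -∑ i, c i * ℓ i 0 := by simp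
  rcases lt_trichotomy (∑ i, c i * ℓ i 0) 0 with h | h | h
  · exact key c hconst (Or.inl h)
  · rcases lt_or_gt_of_ne hi₀ with h' | h'
    · exact key (-c) hneg (Or.inr ⟨by rw [hneg0, h, neg_zero], i₀, by simpa using h'⟩)
    · exact key c hconst (Or.inr ⟨h, i₀, h'⟩)
  · exact key (-c) hneg (Or.inl (by rw [hneg0]; linarith))

lemma sum_choose_le_pow (w k : ℕ) : ∑ i ∈ Finset.Iic k, w.choose i ≤ (w + 1) ^ k := by
  rw [add_pow, ← Nat.range_succ_eq_Iic]
  refine Finset.sum_le_sum fun i hi => ?_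
  have hi' : i ≤ k := Nat.lt_succ_iff.1 (Finset.mem_range.1 hi)
  rw [one_pow, mul_one]
  calc w.choose i ≤ w ^ i := Nat.choose_le_pow w i
    _ ≤ w ^ i * k.choose i := Nat.le_mul_of_pos_right _ (Nat.choose_pos hi')

open Classical in
/-- `w` affine functions on a space of dimension `k` realise at most `(w + 1) ^ k` sign patterns. -/
lemma exists_finset_signPatterns {V ι : Type*} [AddCommGroup V] [Module ℝ V]
    [FiniteDimensional ℝ V] [Fintype ι] (ℓ : ι → (V →ᵃ[ℝ] ℝ)) :
    ∃ 𝒜 : Finset (Finset ι), 𝒜.card ≤ (Fintype.card ι + 1) ^ Module.finrank ℝ V ∧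
      ∀ z, (Finset.univ.filter fun i => 0 < ℓ i z) ∈ 𝒜 := by
  let 𝒜 : Finset (Finset ι) :=
    Finset.univ.filter fun s => ∃ z, (Finset.univ.filter fun i => 0 < ℓ i z) = s
  refine ⟨𝒜, ?_, fun z => by simp [𝒜]⟩
  -- On a shattered set the corresponding affine functions realise every sign pattern, so its size
  -- is at most the dimension; Sauer–Shelah then bounds the family.
  have hvc : 𝒜.vcDim ≤ Module.finrank ℝ V := by
    refine Finset.sup_le fun s hs => ?_
    rw [Finset.mem_shatterer] at hs
    by_contra! hlt
    obtain ⟨T, hT⟩ := exists_signPattern_not_realized (κ := s)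
      (by simpa using hlt) (fun i => ℓ i)
    obtain ⟨u, hu, hsu⟩ := hs (t := s.filter fun i => ∃ h : i ∈ s, (⟨i, h⟩ : s) ∈ T)
      (Finset.filter_subset _ _)
    simp only [𝒜, Finset.mem_filter, Finset.mem_univ, true_and] at hu
    obtain ⟨z, rfl⟩ := hu
    refine hT z (Set.ext fun i => ?_)
    have := Finset.ext_iff.1 hsu i
    simpa using this
  calc 𝒜.card ≤ 𝒜.shatterer.card := Finset.card_le_card_shatterer 𝒜
    _ ≤ ∑ i ∈ Finset.Iic 𝒜.vcDim, (Fintype.card ι).choose i :=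
      Finset.card_shatterer_le_sum_vcDim
    _ ≤ ∑ i ∈ Finset.Iic (Module.finrank ℝ V), (Fintype.card ι).choose i :=
      Finset.sum_le_sum_of_subset (Finset.Iic_subset_Iic.2 hvc)
    _ ≤ _ := sum_choose_le_pow _ _

/-- `F` agrees at every point with one of at most `N` affine maps. -/
def IsPiecewiseAffine (N : ℕ) {k l : ℕ}
    (F : EuclideanSpace ℝ (Fin k) → EuclideanSpace ℝ (Fin l)) : Prop :=
  ∃ S : Finset (EuclideanSpace ℝ (Fin k) →ᵃ[ℝ] EuclideanSpace ℝ (Fin l)),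
    S.card ≤ N ∧ ∀ z, ∃ f ∈ S, F z = f z

lemma IsPiecewiseAffine.mono {N N' k l : ℕ} (h : N ≤ N')
    {F : EuclideanSpace ℝ (Fin k) → EuclideanSpace ℝ (Fin l)} (hF : IsPiecewiseAffine N F) :
    IsPiecewiseAffine N' F :=
  let ⟨S, hS, hF⟩ := hF
  ⟨S, hS.trans h, hF⟩

/-- `affineLayer` as an affine map. -/
noncomputable def affineLayerMap {l l' : ℕ} (W : Matrix (Fin l') (Fin l) ℝ)
    (β : EuclideanSpace ℝ (Fin l')) : EuclideanSpace ℝ (Fin l) →ᵃ[ℝ] EuclideanSpace ℝ (Fin l') :=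
  (Matrix.toLpLin 2 2 W).toAffineMap + AffineMap.const ℝ _ β

lemma affineLayerMap_apply {l l' : ℕ} (W : Matrix (Fin l') (Fin l) ℝ)
    (β : EuclideanSpace ℝ (Fin l')) (x : EuclideanSpace ℝ (Fin l)) :
    affineLayerMap W β x = affineLayer W β x := by
  ext i
  simp [affineLayerMap, affineLayer]

open Classical in
lemma IsPiecewiseAffine.affineLayer {N k l l' : ℕ}
    {F : EuclideanSpace ℝ (Fin k) → EuclideanSpace ℝ (Fin l)} (hF : IsPiecewiseAffine N F)
    (W : Matrix (Fin l') (Fin l) ℝ) (β : EuclideanSpace ℝ (Fin l')) :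
    IsPiecewiseAffine N (fun z => affineLayer W β (F z)) := by
  obtain ⟨S, hS, hF⟩ := hF
  refine ⟨S.image fun f => (affineLayerMap W β).comp f, Finset.card_image_le.trans hS,
    fun z => ?_⟩
  obtain ⟨f, hf, hz⟩ := hF z
  exact ⟨_, Finset.mem_image_of_mem _ hf, by simp [hz, affineLayerMap_apply]⟩

/-- The coordinate projection onto the coordinates in `s`. -/
noncomputable def maskMap {l : ℕ} (s : Finset (Fin l)) :
    EuclideanSpace ℝ (Fin l) →ₗ[ℝ] EuclideanSpace ℝ (Fin l) :=
  Matrix.toLpLin 2 2 (Matrix.diagonal fun i => if i ∈ s then (1 : ℝ) else 0)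

lemma maskMap_apply {l : ℕ} (s : Finset (Fin l)) (x : EuclideanSpace ℝ (Fin l)) (i : Fin l) :
    maskMap s x i = if i ∈ s then x i else 0 := by
  simp [maskMap, Matrix.mulVec_diagonal]

lemma maskMap_filter_pos {l : ℕ} (x : EuclideanSpace ℝ (Fin l))
    [DecidablePred fun i => 0 < x i] :
    maskMap (Finset.univ.filter fun i => 0 < x i) x = relu x := by
  ext i
  rw [maskMap_apply]
  by_cases h : 0 < x i
  · simp [relu, h, h.le]
  · simp [relu, h, not_lt.1 h]

-- On one affine piece, ReLU acts as the coordinate projection onto the positive coordinates. Their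
-- sign patterns are counted after pulling back to the input space `ℝᵏ`, so the exponent stays `k`
-- at every depth.
open Classical in
lemma IsPiecewiseAffine.relu {N k l : ℕ}
    {F : EuclideanSpace ℝ (Fin k) → EuclideanSpace ℝ (Fin l)} (hF : IsPiecewiseAffine N F) :
    IsPiecewiseAffine (N * (l + 1) ^ k) (fun z => relu (F z)) := by
  obtain ⟨S, hS, hF⟩ := hF
  have hpat : ∀ f : EuclideanSpace ℝ (Fin k) →ᵃ[ℝ] EuclideanSpace ℝ (Fin l),
      ∃ 𝒜 : Finset (Finset (Fin l)), 𝒜.card ≤ (l + 1) ^ k ∧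
        ∀ z, (Finset.univ.filter fun i => 0 < f z i) ∈ 𝒜 := fun f => by
    simpa using exists_finset_signPatterns
      fun i => (EuclideanSpace.projₗ (𝕜 := ℝ) i).toAffineMap.comp f
  choose 𝒜 h𝒜 hmem using hpat
  refine ⟨S.biUnion fun f => (𝒜 f).image fun s => (maskMap s).toAffineMap.comp f, ?_,
    fun z => ?_⟩
  · refine (Finset.card_biUnion_le_card_mul _ _ _ fun f _ =>
      Finset.card_image_le.trans (h𝒜 f)).trans ?_
    gcongr
  · obtain ⟨f, hf, hz⟩ := hF z
    refine ⟨_, Finset.mem_biUnion.2 ⟨f, hf, Finset.mem_image_of_mem _ (hmem f z)⟩, ?_⟩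
    simp [hz, maskMap_filter_pos]

lemma IsReLUStack.isPiecewiseAffine {w k h l : ℕ}
    {F : EuclideanSpace ℝ (Fin k) → EuclideanSpace ℝ (Fin l)} (hF : IsReLUStack w k h l F) :
    IsPiecewiseAffine (((w + 1) ^ k) ^ h) F := by
  induction hF with
  | input => exact ⟨{AffineMap.id ℝ _}, by simp, fun z => ⟨_, Finset.mem_singleton_self _, rfl⟩⟩
  | layer hF hl' W β ih =>
    refine (ih.affineLayer W β).relu.mono ?_
    rw [pow_succ]
    gcongr

lemma IsReLUNetwork.isPiecewiseAffine {w d k n : ℕ}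
    {G : EuclideanSpace ℝ (Fin k) → EuclideanSpace ℝ (Fin n)} (hG : IsReLUNetwork w d k n G) :
    IsPiecewiseAffine (((w + 1) ^ k) ^ (d - 1) * (n + 1) ^ k) G := by
  obtain ⟨h, l, F, W, β, rfl, hF, rfl | rfl⟩ := hG
  · exact (hF.isPiecewiseAffine.affineLayer W β).relu
  · exact (hF.isPiecewiseAffine.affineLayer W β).mono
      (Nat.le_mul_of_pos_right _ (by positivity))

/-- The increments of a piecewise affine map on `ℝᵏ` lie in finitely many subspaces of
dimension at most `k + 1`. -/
lemma IsPiecewiseAffine.exists_submodules {N k l : ℕ}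
    {F : EuclideanSpace ℝ (Fin k) → EuclideanSpace ℝ (Fin l)} (hF : IsPiecewiseAffine N F)
    (x : EuclideanSpace ℝ (Fin l)) :
    ∃ 𝓔 : Finset (Submodule ℝ (EuclideanSpace ℝ (Fin l))), 𝓔.card ≤ N ∧
      (∀ E ∈ 𝓔, Module.finrank ℝ E ≤ k + 1) ∧ ∀ z, ∃ E ∈ 𝓔, F z - x ∈ E := by
  classical
  obtain ⟨S, hS, hF⟩ := hF
  -- On a piece, `F z - x = f.linear z + (f 0 - x)`; the offset costs the one extra dimension.
  refine ⟨S.image fun f => LinearMap.range f.linear ⊔ Submodule.span ℝ {f 0 - x},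
    Finset.card_image_le.trans hS, fun E hE => ?_, fun z => ?_⟩
  · obtain ⟨f, -, rfl⟩ := Finset.mem_image.1 hE
    have h1 : Module.finrank ℝ (LinearMap.range f.linear) ≤ k := by
      simpa using LinearMap.finrank_range_le f.linear
    have h2 := finrank_span_le_card (R := ℝ) ({f 0 - x} : Set (EuclideanSpace ℝ (Fin l)))
    have h3 := Submodule.finrank_add_le_finrank_add_finrank
      (LinearMap.range f.linear) (Submodule.span ℝ {f 0 - x})
    simp only [Set.toFinset_singleton, Finset.card_singleton] at h2
    omega
  · obtain ⟨f, hf, hz⟩ := hF z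
    refine ⟨_, Finset.mem_image_of_mem _ hf, Submodule.mem_sup.2
      ⟨f.linear z, ⟨z, rfl⟩, f 0 - x, Submodule.mem_span_singleton_self _, ?_⟩⟩
    have h1 : f z = f.linear z + f 0 := by
      conv_lhs => rw [AffineMap.decomp f]
      rfl
    rw [hz, h1]
    abel

end Regions

/-! ### Nets on unit spheres of subspaces. -/

section Net

/-- The unit sphere of an `r`-dimensional subspace of `ℝⁿ` has a `1 / (2 n)`-net with at most
`(5 n²) ^ r` points. -/
lemma exists_net_unitSphere {n r : ℕ} (hn : 1 ≤ n)
    (E : Submodule ℝ (EuclideanSpace ℝ (Fin n))) (hE : Module.finrank ℝ E ≤ r) :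
    ∃ S : Finset (EuclideanSpace ℝ (Fin n)), S.card ≤ (5 * n ^ 2) ^ r ∧ (∀ s ∈ S, ‖s‖ ≤ 2) ∧
      ∀ v ∈ E, ‖v‖ = 1 → ∃ s ∈ S, ‖v - s‖ ≤ 1 / (2 * n) := by
  classical
  have hn0 : (0 : ℝ) < n := by exact_mod_cast hn
  let e := stdOrthonormalBasis ℝ E
  -- Orthonormal coordinates are rounded to multiples of `1 / (2 n²)`. At most `n` coordinates
  -- contribute, for a total error of at most `1 / (2n)`; each takes `4 n² + 1 ≤ 5 n²` values.
  let P : (Fin (Module.finrank ℝ E) → ℤ) → EuclideanSpace ℝ (Fin n) := fun q =>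
    ∑ i, ((q i : ℝ) / (2 * n ^ 2)) • (e i : EuclideanSpace ℝ (Fin n))
  let grid := Fintype.piFinset fun _ : Fin (Module.finrank ℝ E) =>
    Finset.Icc (-(2 * n ^ 2 : ℤ)) (2 * n ^ 2)
  have hgrid : grid.card ≤ (5 * n ^ 2) ^ r := by
    have h1 : grid.card = (4 * n ^ 2 + 1) ^ Module.finrank ℝ E := by
      simp only [grid, Fintype.card_piFinset_const, Int.card_Icc]
      congr 1
      have : (2 * (n : ℤ) ^ 2 + 1 - -(2 * (n : ℤ) ^ 2)) = ((4 * n ^ 2 + 1 : ℕ) : ℤ) := by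
        push_cast; ring
      rw [this, Int.toNat_natCast]
    have h2 : 1 ≤ n ^ 2 := Nat.one_le_pow _ _ hn
    rw [h1]
    calc (4 * n ^ 2 + 1) ^ Module.finrank ℝ E ≤ (5 * n ^ 2) ^ Module.finrank ℝ E :=
          Nat.pow_le_pow_left (by omega) _
      _ ≤ (5 * n ^ 2) ^ r := Nat.pow_le_pow_right (by omega) hE
  refine ⟨(grid.image P).filter fun s => ‖s‖ ≤ 2,
    (Finset.card_filter_le _ _).trans (Finset.card_image_le.trans hgrid),
    fun s hs => (Finset.mem_filter.1 hs).2, fun v hv hv1 => ?_⟩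
  have hv1' : ‖(⟨v, hv⟩ : E)‖ = 1 := hv1
  let c : Fin (Module.finrank ℝ E) → ℝ := fun i => e.repr ⟨v, hv⟩ i
  have hc : ∀ i, |c i| ≤ 1 := fun i => by
    have h := PiLp.norm_apply_le (e.repr ⟨v, hv⟩) i
    rwa [LinearIsometryEquiv.norm_map, hv1', Real.norm_eq_abs] at h
  have hvc : v = ∑ i, c i • (e i : EuclideanSpace ℝ (Fin n)) := by
    have h := congrArg (fun x : E => (x : EuclideanSpace ℝ (Fin n))) (e.sum_repr ⟨v, hv⟩)
    simpa [c] using h.symm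
  let q : Fin (Module.finrank ℝ E) → ℤ := fun i => ⌊c i * (2 * n ^ 2)⌋
  have hn2 : (0 : ℝ) < 2 * n ^ 2 := by positivity
  have hclose : ‖v - P q‖ ≤ 1 / (2 * n) := by
    have hterm : ∀ i, |c i - (q i : ℝ) / (2 * n ^ 2)| ≤ 1 / (2 * (n : ℝ) ^ 2) := fun i => by
      have h1 := Int.floor_le (c i * (2 * n ^ 2))
      have h2 := Int.lt_floor_add_one (c i * (2 * n ^ 2))
      have h3 : c i - (q i : ℝ) / (2 * n ^ 2) = (c i * (2 * n ^ 2) - q i) / (2 * n ^ 2) := by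
        field_simp
      rw [h3, abs_div, abs_of_pos hn2]
      gcongr
      rw [abs_le]
      constructor <;> simp only [q] <;> linarith
    have hrank : (Module.finrank ℝ E : ℝ) ≤ n := by
      have h := Submodule.finrank_le E
      rw [finrank_euclideanSpace_fin] at h
      exact_mod_cast h
    have hdiff : v - P q =
        ∑ i, (c i - (q i : ℝ) / (2 * n ^ 2)) • (e i : EuclideanSpace ℝ (Fin n)) := by
      conv_lhs => rw [hvc]
      simp only [P, sub_smul, Finset.sum_sub_distrib]
    calc ‖v - P q‖ ≤ ∑ i : Fin (Module.finrank ℝ E), 1 / (2 * n ^ 2 : ℝ) := by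
          rw [hdiff]
          refine norm_sum_le_of_le _ fun i _ => ?_
          have h1 : ‖(e i : EuclideanSpace ℝ (Fin n))‖ = 1 := e.orthonormal.1 i
          rw [norm_smul, h1, mul_one]
          exact hterm i
      _ = Module.finrank ℝ E * (1 / (2 * n ^ 2 : ℝ)) := by simp
      _ ≤ n * (1 / (2 * n ^ 2 : ℝ)) := by gcongr
      _ = 1 / (2 * n) := by field_simp
  have hmem : q ∈ grid := by
    refine Fintype.mem_piFinset.2 fun i => Finset.mem_Icc.2 ⟨Int.le_floor.2 ?_, ?_⟩
    · push_cast
      nlinarith [(abs_le.1 (hc i)).1]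
    · have h : c i * (2 * n ^ 2) ≤ 2 * n ^ 2 := by nlinarith [(abs_le.1 (hc i)).2]
      have h' : ((q i : ℤ) : ℝ) ≤ ((2 * n ^ 2 : ℤ) : ℝ) := by
        push_cast
        exact (Int.floor_le _).trans h
      exact_mod_cast h'
  refine ⟨P q, Finset.mem_filter.2 ⟨Finset.mem_image_of_mem _ hmem, ?_⟩, hclose⟩
  have hle : 1 / (2 * n : ℝ) ≤ 1 := by
    have : (1 : ℝ) ≤ n := by exact_mod_cast hn
    rw [div_le_one (by positivity)]
    linarith
  calc ‖P q‖ = ‖v - (v - P q)‖ := by rw [sub_sub_cancel]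
    _ ≤ ‖v‖ + ‖v - P q‖ := norm_sub_le _ _
    _ ≤ 2 := by linarith

end Net

/-! ### Tail bounds and the uniform majority estimate. -/

section Tail

variable {Ω : Type*} [MeasurableSpace Ω] {μ : Measure Ω}

open Classical in
/-- It is unlikely that more than a twentieth of `M` independent rare events occur. -/
lemma measureReal_card_gt_le [IsProbabilityMeasure μ] {M : ℕ} (E : Fin M → Set Ω)
    (hind : ∀ T : Finset (Fin M), μ.real (⋂ j ∈ T, E j) = ∏ j ∈ T, μ.real (E j))
    (hE : ∀ j, μ.real (E j) ≤ Real.exp (-80)) :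
    μ.real {ω | (M : ℝ) / 20 < (Finset.univ.filter fun j => ω ∈ E j).card} ≤
      Real.exp (-3 * M) := by
  -- Union bound over the possible sets of failing indices: at most `2 ^ M ≤ exp M` of them, each of
  -- probability at most `exp (-80 * M / 20) = exp (-4 M)`.
  let 𝒯 : Finset (Finset (Fin M)) := Finset.univ.filter fun T => (M : ℝ) / 20 < T.card
  have hsub : {ω | (M : ℝ) / 20 < (Finset.univ.filter fun j => ω ∈ E j).card} ⊆
      ⋃ T ∈ 𝒯, ⋂ j ∈ T, E j := fun ω hω => by
    refine Set.mem_iUnion₂.2 ⟨Finset.univ.filter fun j => ω ∈ E j,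
      Finset.mem_filter.2 ⟨Finset.mem_univ _, hω⟩, Set.mem_iInter₂.2 fun j hj => ?_⟩
    exact (Finset.mem_filter.1 hj).2
  have hT : ∀ T ∈ 𝒯, μ.real (⋂ j ∈ T, E j) ≤ Real.exp (-4 * M) := fun T hT => by
    have hT' : (M : ℝ) / 20 < T.card := (Finset.mem_filter.1 hT).2
    calc μ.real (⋂ j ∈ T, E j) = ∏ j ∈ T, μ.real (E j) := hind T
      _ ≤ ∏ _j ∈ T, Real.exp (-80) :=
        Finset.prod_le_prod (fun _ _ => measureReal_nonneg) fun j _ => hE j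
      _ = Real.exp (T.card * (-80)) := by rw [Finset.prod_const, Real.exp_nat_mul]
      _ ≤ Real.exp (-4 * M) := Real.exp_le_exp.2 (by linarith)
  have hcard : (𝒯.card : ℝ) ≤ Real.exp M := by
    have h1 : 𝒯.card ≤ 2 ^ M := (Finset.card_filter_le _ _).trans (by simp)
    have h2 : (2 : ℝ) ≤ Real.exp 1 := by linarith [Real.add_one_le_exp (1 : ℝ)]
    calc (𝒯.card : ℝ) ≤ 2 ^ M := by exact_mod_cast h1
      _ ≤ Real.exp 1 ^ M := by gcongr
      _ = Real.exp M := by rw [← Real.exp_nat_mul, mul_one]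
  calc _ ≤ μ.real (⋃ T ∈ 𝒯, ⋂ j ∈ T, E j) := measureReal_mono hsub (measure_ne_top _ _)
    _ ≤ ∑ T ∈ 𝒯, μ.real (⋂ j ∈ T, E j) := measureReal_biUnion_finset_le _ _
    _ ≤ ∑ _T ∈ 𝒯, Real.exp (-4 * M) := Finset.sum_le_sum hT
    _ = 𝒯.card * Real.exp (-4 * M) := by rw [Finset.sum_const, nsmul_eq_mul]
    _ ≤ Real.exp M * Real.exp (-4 * M) := by gcongr
    _ = Real.exp (-3 * M) := by rw [← Real.exp_add]; ring_nf

/-- Chebyshev's inequality, in product form to avoid dividing by `a ^ 2`. -/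
lemma measureReal_lt_abs_le {f : Ω → ℝ} [IsProbabilityMeasure μ] {a s q : ℝ} (ha : 0 < a)
    (hf : Integrable (fun ω => f ω ^ 2) μ) (hs : ∫ ω, f ω ^ 2 ∂μ ≤ s) (hq : s ≤ a ^ 2 * q) :
    μ.real {ω | a < |f ω|} ≤ q := by
  have h1 := mul_meas_ge_le_integral_of_nonneg
    (Filter.Eventually.of_forall fun ω => sq_nonneg (f ω)) hf (a ^ 2)
  have h2 : μ.real {ω | a < |f ω|} ≤ μ.real {ω | a ^ 2 ≤ f ω ^ 2} :=
    measureReal_mono fun ω (hω : a < |f ω|) => by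
      change a ^ 2 ≤ f ω ^ 2
      rw [sq_le_sq, abs_of_pos ha]
      exact hω.le
  have h3 : a ^ 2 * μ.real {ω | a ^ 2 ≤ f ω ^ 2} ≤ a ^ 2 * q := h1.trans (hs.trans hq)
  exact h2.trans (le_of_mul_le_mul_left h3 (by positivity))

/-- Independent random vectors with small second moments have, uniformly over finitely many
subspaces of dimension at most `r`, small marginals for most indices. -/
theorem one_sub_exp_le_measureReal_uniform_majority [IsProbabilityMeasure μ] {n r M : ℕ}
    (hn : 1 ≤ n) {X : Fin M → Ω → EuclideanSpace ℝ (Fin n)}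
    (hind : iIndepFun X μ) {s t : ℝ} (ht : 0 < t)
    (hint : ∀ j v, Integrable (fun ω => inner ℝ (X j ω) v ^ 2) μ)
    (hmom : ∀ j v, ∫ ω, inner ℝ (X j ω) v ^ 2 ∂μ ≤ s * ‖v‖ ^ 2)
    (hst : 16 * Real.exp 80 * s ≤ t ^ 2)
    (𝓔 : Finset (Submodule ℝ (EuclideanSpace ℝ (Fin n))))
    (hr : ∀ E ∈ 𝓔, Module.finrank ℝ E ≤ r)
    (hcard : (𝓔.card : ℝ) * (5 * n ^ 2) ^ r + 1 ≤ Real.exp (2 * M)) :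
    1 - Real.exp (-M) ≤ μ.real {ω | ∀ E ∈ 𝓔, ∀ v ∈ E, ∃ J : Finset (Fin M),
      (9 / 10 : ℝ) * M ≤ J.card ∧ ∀ j ∈ J, |inner ℝ (X j ω) v| ≤ t * ‖v‖} := by
  classical
  rcases Nat.eq_zero_or_pos M with rfl | hM
  · simp
  have hn1 : (1 : ℝ) ≤ n := by exact_mod_cast hn
  have hn0 : (0 : ℝ) < n := by linarith
  have hst' : 16 * s ≤ t ^ 2 * Real.exp (-80) := by
    rw [Real.exp_neg, ← div_eq_mul_inv, le_div_iff₀ (Real.exp_pos _)]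
    linarith
  have hs0 : 0 ≤ s := by
    have h := (integral_nonneg fun ω => sq_nonneg _).trans
      (hmom ⟨0, hM⟩ (EuclideanSpace.single ⟨0, hn⟩ 1))
    simpa using h
  have hsq : ∀ j ω, ‖X j ω‖ ^ 2 = ∑ i, inner ℝ (X j ω) (EuclideanSpace.single i 1) ^ 2 :=
    fun j ω => by simp [EuclideanSpace.norm_sq_eq, EuclideanSpace.inner_single_right]
  have hintn : ∀ j, Integrable (fun ω => ‖X j ω‖ ^ 2) μ := fun j => by
    simp_rw [hsq]
    exact integrable_finsetSum _ fun i _ => hint j _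
  have hmomn : ∀ j, ∫ ω, ‖X j ω‖ ^ 2 ∂μ ≤ n * s := fun j => by
    simp_rw [hsq]
    rw [integral_finsetSum _ fun i _ => hint j _]
    calc _ ≤ ∑ _i : Fin n, s := Finset.sum_le_sum fun i _ => by
          simpa using hmom j (EuclideanSpace.single i 1)
      _ = n * s := by simp
  have hprod : ∀ U : Set (EuclideanSpace ℝ (Fin n)), MeasurableSet U → ∀ T : Finset (Fin M),
      μ.real (⋂ j ∈ T, X j ⁻¹' U) = ∏ j ∈ T, μ.real (X j ⁻¹' U) := fun U hU T => by
    rw [measureReal_def, hind.measure_inter_preimage_eq_mul T (sets := fun _ => U)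
      fun _ _ => hU, ENNReal.toReal_prod]
    rfl
  -- the events that must be avoided
  let badN : Set Ω := {ω | (M : ℝ) / 20 <
    (Finset.univ.filter fun j => ω ∈ X j ⁻¹' {x | n * t < |‖x‖|}).card}
  let bad : EuclideanSpace ℝ (Fin n) → Set Ω := fun v => {ω | (M : ℝ) / 20 <
    (Finset.univ.filter fun j => ω ∈ X j ⁻¹' {x | t / 2 < |inner ℝ x v|}).card}
  have hbadN : μ.real badN ≤ Real.exp (-3 * M) := by
    refine measureReal_card_gt_le _ (hprod _ ?_) fun j => ?_
    · exact (isOpen_lt continuous_const (by fun_prop)).measurableSet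
    · refine measureReal_lt_abs_le (by positivity) (hintn j) (hmomn j) ?_
      have h1 : n * s ≤ n ^ 2 * (16 * s) := by
        have h2 : (n : ℝ) ≤ n ^ 2 * 16 := by nlinarith
        calc n * s ≤ (n ^ 2 * 16) * s := by gcongr
          _ = _ := by ring
      calc n * s ≤ n ^ 2 * (16 * s) := h1
        _ ≤ n ^ 2 * (t ^ 2 * Real.exp (-80)) := by gcongr
        _ = _ := by ring
  have hbad : ∀ v, ‖v‖ ≤ 2 → μ.real (bad v) ≤ Real.exp (-3 * M) := fun v hv => by
    refine measureReal_card_gt_le _ (hprod _ ?_) fun j => ?_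
    · exact (isOpen_lt continuous_const (by fun_prop)).measurableSet
    · refine measureReal_lt_abs_le (by positivity) (hint j v) (hmom j v) ?_
      -- The factor `16` in `hst` is spent here: `4` for `‖v‖ ≤ 2` and `4` for the halved threshold
      -- `t / 2`.
      calc s * ‖v‖ ^ 2 ≤ s * 2 ^ 2 := by gcongr
        _ ≤ _ := by linarith
  have hnet : ∀ E : Submodule ℝ (EuclideanSpace ℝ (Fin n)),
      ∃ S : Finset (EuclideanSpace ℝ (Fin n)), E ∈ 𝓔 → S.card ≤ (5 * n ^ 2) ^ r ∧
        (∀ s ∈ S, ‖s‖ ≤ 2) ∧ ∀ v ∈ E, ‖v‖ = 1 → ∃ s ∈ S, ‖v - s‖ ≤ 1 / (2 * n) := fun E => by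
    by_cases hE : E ∈ 𝓔
    · obtain ⟨S, hS⟩ := exists_net_unitSphere hn E (hr E hE)
      exact ⟨S, fun _ => hS⟩
    · exact ⟨∅, fun h => absurd h hE⟩
  choose S hS using hnet
  let 𝓢 := 𝓔.biUnion S
  have h𝓢card : (𝓢.card : ℝ) ≤ 𝓔.card * (5 * n ^ 2) ^ r := by
    exact_mod_cast Finset.card_biUnion_le_card_mul 𝓔 S _ fun E hE => (hS E hE).1
  have h𝓢norm : ∀ v ∈ 𝓢, ‖v‖ ≤ 2 := fun v hv => by
    obtain ⟨E, hE, hv⟩ := Finset.mem_biUnion.1 hv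
    exact (hS E hE).2.1 v hv
  have htotal : μ.real (badN ∪ ⋃ v ∈ 𝓢, bad v) ≤ Real.exp (-M) := by
    calc μ.real (badN ∪ ⋃ v ∈ 𝓢, bad v)
        ≤ μ.real badN + ∑ v ∈ 𝓢, μ.real (bad v) :=
          (measureReal_union_le _ _).trans
            (add_le_add_right (measureReal_biUnion_finset_le _ _) _)
      _ ≤ Real.exp (-3 * M) + ∑ _v ∈ 𝓢, Real.exp (-3 * M) :=
          add_le_add hbadN (Finset.sum_le_sum fun v hv => hbad v (h𝓢norm v hv))
      _ = (𝓢.card + 1) * Real.exp (-3 * M) := by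
          rw [Finset.sum_const, nsmul_eq_mul]; ring
      -- The `+ 1` in `hcard` pays for the norm event `badN`.
      _ ≤ Real.exp (2 * M) * Real.exp (-3 * M) := by gcongr; linarith
      _ = Real.exp (-M) := by rw [← Real.exp_add]; ring_nf
  have hgood : (badN ∪ ⋃ v ∈ 𝓢, bad v)ᶜ ⊆ {ω | ∀ E ∈ 𝓔, ∀ v ∈ E, ∃ J : Finset (Fin M),
      (9 / 10 : ℝ) * M ≤ J.card ∧ ∀ j ∈ J, |inner ℝ (X j ω) v| ≤ t * ‖v‖} := by
    intro ω hω E hE v hv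
    rw [Set.mem_compl_iff, Set.mem_union, not_or] at hω
    obtain ⟨hωN, hωS⟩ := hω
    rcases eq_or_ne v 0 with rfl | hv0
    · exact ⟨Finset.univ, by simp; nlinarith [(Nat.cast_nonneg M : (0 : ℝ) ≤ M)], by simp⟩
    have hv' : 0 < ‖v‖ := norm_pos_iff.2 hv0
    obtain ⟨u, hu, hvu⟩ := (hS E hE).2.2 (‖v‖⁻¹ • v) (E.smul_mem _ hv)
      (by rw [norm_smul, norm_inv, norm_norm, inv_mul_cancel₀ hv'.ne'])
    have hωu : ω ∉ bad u := fun h =>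
      hωS (Set.mem_iUnion₂.2 ⟨u, Finset.mem_biUnion.2 ⟨E, hE, hu⟩, h⟩)
    set J₁ := Finset.univ.filter fun j => ω ∈ X j ⁻¹' {x | n * t < |‖x‖|}
    set J₂ := Finset.univ.filter fun j => ω ∈ X j ⁻¹' {x | t / 2 < |inner ℝ x u|}
    have h1 : (J₁.card : ℝ) ≤ M / 20 := not_lt.1 hωN
    have h2 : (J₂.card : ℝ) ≤ M / 20 := not_lt.1 hωu
    -- Two exceptional sets of at most `M / 20` indices leave at least `0.9 M`.
    refine ⟨(J₁ ∪ J₂)ᶜ, ?_, fun j hj => ?_⟩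
    · have h3 : (((J₁ ∪ J₂)ᶜ).card : ℝ) + (J₁ ∪ J₂).card = M := by
        have := Finset.card_compl_add_card (J₁ ∪ J₂)
        rw [Fintype.card_fin] at this
        exact_mod_cast this
      have h4 : ((J₁ ∪ J₂).card : ℝ) ≤ J₁.card + J₂.card := by
        exact_mod_cast Finset.card_union_le J₁ J₂
      linarith
    · rw [Finset.mem_compl, Finset.mem_union, not_or] at hj
      have hj1 : ‖X j ω‖ ≤ n * t := by
        have := hj.1
        simpa [J₁] using this
      have hj2 : |inner ℝ (X j ω) u| ≤ t / 2 := by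
        have := hj.2
        simpa [J₂] using this
      have h5 : |inner ℝ (X j ω) (‖v‖⁻¹ • v)| ≤ t := by
        have h6 : inner ℝ (X j ω) (‖v‖⁻¹ • v) =
            inner ℝ (X j ω) (‖v‖⁻¹ • v - u) + inner ℝ (X j ω) u := by
          rw [← inner_add_right, sub_add_cancel]
        have h7 : |inner ℝ (X j ω) (‖v‖⁻¹ • v - u)| ≤ t / 2 := by
          calc _ ≤ ‖X j ω‖ * ‖‖v‖⁻¹ • v - u‖ := abs_real_inner_le_norm _ _
            _ ≤ (n * t) * (1 / (2 * n)) := by gcongr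
            _ = t / 2 := by field_simp
        rw [h6]
        exact (abs_add_le _ _).trans (by linarith)
      rw [inner_smul_right, abs_mul, abs_inv, abs_norm, inv_mul_le_iff₀ hv'] at h5
      linarith
  -- Subadditivity suffices, so no measurability of the bad event is needed.
  have hcompl : 1 ≤ μ.real (badN ∪ ⋃ v ∈ 𝓢, bad v) + μ.real (badN ∪ ⋃ v ∈ 𝓢, bad v)ᶜ := by
    have h := measureReal_union_le (μ := μ) (badN ∪ ⋃ v ∈ 𝓢, bad v) (badN ∪ ⋃ v ∈ 𝓢, bad v)ᶜ
    rwa [Set.union_compl_self, probReal_univ] at h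
  linarith [measureReal_mono (μ := μ) hgood]

end Tail

/-! ### Independence and second moments of the batch means. -/

section Batches

variable {Ω : Type*} {mΩ : MeasurableSpace Ω} {μ : Measure Ω}

/-- Joins of independent σ-algebras over disjoint index sets are independent. -/
lemma iIndep_iSup_of_pairwise_disjoint [IsProbabilityMeasure μ] {ι κ : Type*}
    {m : ι → MeasurableSpace Ω} (hm : ∀ i, m i ≤ mΩ) (h : iIndep m μ) {B : κ → Set ι}
    (hB : Pairwise fun i j => Disjoint (B i) (B j)) :
    iIndep (fun j => ⨆ i ∈ B j, m i) μ := by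
  classical
  refine (iIndep_iff _ _).2 fun s f => ?_
  induction s using Finset.induction_on with
  | empty => simp
  | insert j s hj ih =>
    intro hf
    rw [Finset.set_biInter_insert, Finset.prod_insert hj,
      ← ih fun i hi => hf i (Finset.mem_insert_of_mem hi)]
    have hdisj : Disjoint (B j) (⋃ i ∈ s, B i) :=
      Set.disjoint_iUnion₂_right.2 fun i hi => hB fun h => hj (h ▸ hi)
    refine (Indep_iff _ _ _).1 (indep_iSup_of_disjoint hm h hdisj) _ _
      (hf j (Finset.mem_insert_self _ _)) ?_
    refine MeasurableSet.biInter s.countable_toSet fun i hi => ?_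
    exact (iSup₂_le fun x hx => le_iSup₂ (f := fun x (_ : x ∈ ⋃ i ∈ s, B i) => m x) x
      (Set.mem_iUnion₂.2 ⟨i, hi, hx⟩)) _ (hf i (Finset.mem_insert_of_mem hi))

/-- The averaged vector `(1 / b) ∑ i ∈ S, ηᵢ aᵢ`. -/
noncomputable def batchMean {n m : ℕ} (b : ℕ) (S : Finset (Fin m))
    (A : Ω → Matrix (Fin m) (Fin n) ℝ) (η : Ω → Fin m → ℝ) (ω : Ω) :
    EuclideanSpace ℝ (Fin n) :=
  (1 / (b : ℝ)) • ∑ i ∈ S, η ω i • row A i ω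

lemma measurable_batchMean {m' : MeasurableSpace Ω} {n m : ℕ} (b : ℕ) {S : Finset (Fin m)}
    {A : Ω → Matrix (Fin m) (Fin n) ℝ} {η : Ω → Fin m → ℝ}
    (hA : ∀ i ∈ S, Measurable (row A i)) (hη : ∀ i ∈ S, Measurable fun ω => η ω i) :
    Measurable (batchMean b S A η) := by
  have h : Measurable fun ω => ∑ i ∈ S, η ω i • row A i ω :=
    Finset.measurable_fun_sum _ fun i hi => (hη i hi).smul (hA i hi)
  exact h.const_smul (1 / (b : ℝ))

lemma inner_batchMean {n m : ℕ} (b : ℕ) (S : Finset (Fin m))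
    (A : Ω → Matrix (Fin m) (Fin n) ℝ) (η : Ω → Fin m → ℝ) (ω : Ω)
    (v : EuclideanSpace ℝ (Fin n)) :
    inner ℝ (batchMean b S A η ω) v = 1 / (b : ℝ) * ∑ i ∈ S, η ω i * inner ℝ (row A i ω) v := by
  simp [batchMean, real_inner_smul_left, sum_inner]

lemma abs_multiplier_eq {n m : ℕ} (b : ℕ) (S : Finset (Fin m))
    (A : Ω → Matrix (Fin m) (Fin n) ℝ) (η : Ω → Fin m → ℝ) (ω : Ω)
    (v : EuclideanSpace ℝ (Fin n)) :
    1 / (b : ℝ) * |multiplier (A ω) (η ω) S v| = |inner ℝ (batchMean b S A η ω) v| := by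
  have h : multiplier (A ω) (η ω) S v = ∑ i ∈ S, η ω i * inner ℝ (row A i ω) v := by
    rw [← Finset.sum_coe_sort]
    refine Finset.sum_congr rfl fun i _ => ?_
    simp [batchMatrix, Matrix.mulVec, row, dotProduct, PiLp.inner_apply, mul_comm]
  rw [inner_batchMean, h, abs_mul, abs_of_nonneg (a := 1 / (b : ℝ)) (by positivity)]

namespace IsUncorruptedSample

variable {n m M : ℕ} {C σ : ℝ} {x : EuclideanSpace ℝ (Fin n)}
  {A : Ω → Matrix (Fin m) (Fin n) ℝ} {η y : Ω → Fin m → ℝ}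

/-- Each batch mean is measurable with respect to the pairs indexed by its own batch, and disjoint
batches generate independent σ-algebras. -/
lemma iIndepFun_batchMean [IsProbabilityMeasure μ] (h : IsUncorruptedSample μ C σ x A η y)
    (b : ℕ) {B : Fin M → Finset (Fin m)} (hB : Pairwise fun i j => Disjoint (B i) (B j)) :
    iIndepFun (fun j => batchMean b (B j) A η) μ := by
  let Z : Fin m → Ω → EuclideanSpace ℝ (Fin n) × ℝ := fun i ω => (row A i ω, η ω i)
  have hZ : ∀ i, Measurable (Z i) := fun i => (h.measurable_row i).prodMk (h.measurable_noise i)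
  have hind := iIndep_iSup_of_pairwise_disjoint (fun i => (hZ i).comap_le)
    ((iIndepFun_iff_iIndep _ _ _).1 h.iIndep) (B := fun j => (B j : Set (Fin m)))
    fun i j hij => Finset.disjoint_coe.2 (hB hij)
  refine (iIndepFun_iff_iIndep _ _ _).2 ((iIndep_iff _ _).2 fun s f hf =>
    hind.meas_biInter fun j hj => ?_)
  obtain ⟨U, hU, hUf⟩ := hf j hj
  rw [← hUf]
  have hZB : ∀ i ∈ B j, Measurable[⨆ i ∈ (B j : Set (Fin m)),
      MeasurableSpace.comap (Z i) inferInstance] (Z i) := fun i hi =>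
    Measurable.of_comap_le (le_iSup₂ (f := fun i (_ : i ∈ (B j : Set (Fin m))) =>
      MeasurableSpace.comap (Z i) inferInstance) i hi)
  have hmeas : Measurable[⨆ i ∈ (B j : Set (Fin m)),
      MeasurableSpace.comap (Z i) inferInstance] (batchMean b (B j) A η) := by
    exact measurable_batchMean b
      (fun i hi => measurable_fst.comp (hZB i hi)) fun i hi => measurable_snd.comp (hZB i hi)
  exact hmeas hU

lemma indepFun_noise_inner (h : IsUncorruptedSample μ C σ x A η y) (i : Fin m)
    (v : EuclideanSpace ℝ (Fin n)) :
    IndepFun (fun ω => η ω i) (fun ω => inner ℝ (row A i ω) v) μ :=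
  (h.indep_noise i).symm.comp measurable_id
    (ψ := fun a : EuclideanSpace ℝ (Fin n) => inner ℝ a v) (by fun_prop)

lemma memLp_inner (h : IsUncorruptedSample μ C σ x A η y) (i : Fin m)
    (v : EuclideanSpace ℝ (Fin n)) : MemLp (fun ω => inner ℝ (row A i ω) v) 2 μ := by
  have hm : Measurable fun ω => inner ℝ (row A i ω) v := (h.measurable_row i).inner_const
  exact (memLp_two_iff_integrable_sq hm.aestronglyMeasurable).2 (h.isotropic i v).1

/-- The squares of the two factors are independent and integrable, hence so is their product
integrable. -/
lemma memLp_noise_mul_inner (h : IsUncorruptedSample μ C σ x A η y) (i : Fin m)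
    (v : EuclideanSpace ℝ (Fin n)) :
    MemLp (fun ω => η ω i * inner ℝ (row A i ω) v) 2 μ := by
  refine (memLp_two_iff_integrable_sq ((h.noise_memLp i).aestronglyMeasurable.mul
    (h.memLp_inner i v).aestronglyMeasurable)).2 ?_
  have hsq : (fun ω => (η ω i * inner ℝ (row A i ω) v) ^ 2) =
      (fun ω => η ω i ^ 2) * fun ω => inner ℝ (row A i ω) v ^ 2 := by
    ext ω
    exact mul_pow _ _ _
  refine (congrArg (Integrable · μ) hsq).mpr ?_
  exact ((h.indepFun_noise_inner i v).comp (φ := fun x => x ^ 2) (ψ := fun x => x ^ 2)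
    (by fun_prop) (by fun_prop)).integrable_mul (h.noise_memLp i).integrable_sq
    (h.memLp_inner i v).integrable_sq

lemma integral_noise_mul_inner (h : IsUncorruptedSample μ C σ x A η y) (i : Fin m)
    (v : EuclideanSpace ℝ (Fin n)) : ∫ ω, η ω i * inner ℝ (row A i ω) v ∂μ = 0 := by
  rw [(h.indepFun_noise_inner i v).integral_fun_mul_eq_mul_integral
    (h.noise_memLp i).aestronglyMeasurable (h.memLp_inner i v).aestronglyMeasurable,
    h.noise_mean i, zero_mul]

lemma integral_noise_sq_le [IsProbabilityMeasure μ] (h : IsUncorruptedSample μ C σ x A η y)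
    (i : Fin m) : ∫ ω, η ω i ^ 2 ∂μ ≤ σ ^ 2 := by
  have := h.noise_variance i
  rwa [variance_of_integral_eq_zero (h.noise_memLp i).aemeasurable (h.noise_mean i)] at this

lemma variance_noise_mul_inner_le [IsProbabilityMeasure μ]
    (h : IsUncorruptedSample μ C σ x A η y) (i : Fin m) (v : EuclideanSpace ℝ (Fin n)) :
    variance (fun ω => η ω i * inner ℝ (row A i ω) v) μ ≤ σ ^ 2 * ‖v‖ ^ 2 := by
  rw [variance_of_integral_eq_zero (h.memLp_noise_mul_inner i v).aemeasurable
    (h.integral_noise_mul_inner i v)]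
  simp_rw [mul_pow]
  have hind := (h.indepFun_noise_inner i v).comp (φ := fun x : ℝ => x ^ 2)
    (ψ := fun x : ℝ => x ^ 2) (by fun_prop) (by fun_prop)
  have := hind.integral_fun_mul_eq_mul_integral
    (h.noise_memLp i).integrable_sq.aestronglyMeasurable
    (h.memLp_inner i v).integrable_sq.aestronglyMeasurable
  simp only [Function.comp_def] at this
  rw [this, (h.isotropic i v).2]
  gcongr
  exact h.integral_noise_sq_le i

lemma integrable_inner_batchMean_sq (h : IsUncorruptedSample μ C σ x A η y) (b : ℕ)
    (S : Finset (Fin m)) (v : EuclideanSpace ℝ (Fin n)) :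
    Integrable (fun ω => inner ℝ (batchMean b S A η ω) v ^ 2) μ := by
  simp_rw [inner_batchMean]
  exact ((memLp_finsetSum _ fun i _ => h.memLp_noise_mul_inner i v).const_mul _).integrable_sq

/-- The summands are centred and pairwise independent, so their variances add to at most `b σ²
‖v‖²`; the normalisation `1 / b²` leaves the gain `1 / b`. -/
lemma integral_inner_batchMean_sq_le [IsProbabilityMeasure μ]
    (h : IsUncorruptedSample μ C σ x A η y) {b : ℕ} (hb : 1 ≤ b) {S : Finset (Fin m)}
    (hS : S.card = b) (v : EuclideanSpace ℝ (Fin n)) :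
    ∫ ω, inner ℝ (batchMean b S A η ω) v ^ 2 ∂μ ≤ σ ^ 2 / b * ‖v‖ ^ 2 := by
  let Y : Fin m → Ω → ℝ := fun i ω => η ω i * inner ℝ (row A i ω) v
  have hY : ∀ i ∈ S, MemLp (Y i) 2 μ := fun i _ => h.memLp_noise_mul_inner i v
  have hb0 : (0 : ℝ) < b := by exact_mod_cast hb
  have hpair : Set.Pairwise (S : Set (Fin m)) fun i j => IndepFun (Y i) (Y j) μ :=
    fun i _ j _ hij => (h.iIndep.indepFun hij).comp
      (φ := fun p : EuclideanSpace ℝ (Fin n) × ℝ => p.2 * inner ℝ p.1 v)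
      (ψ := fun p : EuclideanSpace ℝ (Fin n) × ℝ => p.2 * inner ℝ p.1 v)
      (by fun_prop) (by fun_prop)
  have hmean : ∫ ω, (∑ i ∈ S, Y i) ω ∂μ = 0 := by
    simp_rw [Finset.sum_apply]
    rw [integral_finsetSum _ fun i hi => (hY i hi).integrable one_le_two]
    exact Finset.sum_eq_zero fun i _ => h.integral_noise_mul_inner i v
  have hvar : ∫ ω, (∑ i ∈ S, Y i) ω ^ 2 ∂μ ≤ b * (σ ^ 2 * ‖v‖ ^ 2) := by
    rw [← variance_of_integral_eq_zero (memLp_finsetSum' _ hY).aemeasurable hmean,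
      IndepFun.variance_sum hY hpair]
    calc _ ≤ ∑ _i ∈ S, σ ^ 2 * ‖v‖ ^ 2 :=
          Finset.sum_le_sum fun i _ => h.variance_noise_mul_inner_le i v
      _ = b * (σ ^ 2 * ‖v‖ ^ 2) := by rw [Finset.sum_const, hS, nsmul_eq_mul]
  simp_rw [inner_batchMean, mul_pow]
  rw [integral_const_mul]
  simp_rw [Finset.sum_apply] at hvar
  calc _ ≤ (1 / (b : ℝ)) ^ 2 * (b * (σ ^ 2 * ‖v‖ ^ 2)) := by gcongr
    _ = σ ^ 2 / b * ‖v‖ ^ 2 := by field_simp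

/-- If the noise has variance zero, all multiplier terms vanish almost surely. -/
lemma measureReal_multiplierBound_of_sigma_eq_zero [IsProbabilityMeasure μ] {k : ℕ}
    (h : IsUncorruptedSample μ C 0 x A η y)
    (G : EuclideanSpace ℝ (Fin k) → EuclideanSpace ℝ (Fin n)) (zstar : EuclideanSpace ℝ (Fin k))
    (b : ℕ) (B : Fin M → Finset (Fin m)) :
    μ.real {ω | MultiplierBound G zstar b B 0 (A ω) (η ω)} = 1 := by
  have hη : ∀ i, ∀ᵐ ω ∂μ, η ω i = 0 := fun i => by
    have h1 : ∫ ω, η ω i ^ 2 ∂μ = 0 := le_antisymm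
      (by simpa using h.integral_noise_sq_le i) (integral_nonneg fun ω => sq_nonneg _)
    have h2 := (integral_eq_zero_iff_of_nonneg (fun ω => sq_nonneg (η ω i))
      (h.noise_memLp i).integrable_sq).1 h1
    filter_upwards [h2] with ω hω
    simpa using hω
  have hae : {ω | MultiplierBound G zstar b B 0 (A ω) (η ω)} =ᵐ[μ] Set.univ := by
    refine Filter.eventuallyEq_univ.2 ?_
    filter_upwards [ae_all_iff.2 hη] with ω hω z
    refine ⟨Finset.univ, by simp; nlinarith [(Nat.cast_nonneg M : (0 : ℝ) ≤ M)], fun j _ => ?_⟩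
    rw [abs_multiplier_eq, inner_batchMean]
    simp [hω]
  rw [measureReal_congr hae, probReal_univ]

end IsUncorruptedSample

end Batches

/-! ### Cardinality of the union bound. -/

section Counting

/-- The cardinality estimate behind the union bound over linear pieces and net points. -/
lemma pieces_mul_net_le_exp {p k n d M : ℕ} (hk : 1 ≤ k) (hd : 1 ≤ d) (hn : 2 ≤ n)
    (hM : ((p : ℝ) + 14) * (k * d * Real.log n) ≤ M) :
    (((((n ^ p + 1) ^ k) ^ (d - 1) * (n + 1) ^ k : ℕ) : ℝ)) * (5 * n ^ 2) ^ (k + 1) + 1 ≤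
      Real.exp (2 * M) := by
  have hn1 : 1 ≤ n := by omega
  have h1 : n ^ p + 1 ≤ n ^ (p + 1) := by
    have := Nat.one_le_pow p n hn1
    rw [pow_succ]; nlinarith
  have h2 : n + 1 ≤ n ^ 2 := by nlinarith
  have h3 : 5 * n ^ 2 ≤ n ^ 5 := by
    have : 2 ^ 3 ≤ n ^ 3 := Nat.pow_le_pow_left hn 3
    calc 5 * n ^ 2 ≤ n ^ 3 * n ^ 2 := Nat.mul_le_mul_right _ (by omega)
      _ = n ^ 5 := by ring
  have h4 : ((n ^ p + 1) ^ k) ^ (d - 1) * (n + 1) ^ k * (5 * n ^ 2) ^ (k + 1) + 1 ≤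
      n ^ ((p + 14) * k * d) := by
    calc ((n ^ p + 1) ^ k) ^ (d - 1) * (n + 1) ^ k * (5 * n ^ 2) ^ (k + 1) + 1
        ≤ ((n ^ (p + 1)) ^ k) ^ (d - 1) * (n ^ 2) ^ k * (n ^ 5) ^ (k + 1) + 1 := by gcongr
      _ = n ^ ((p + 1) * k * (d - 1) + 2 * k + 5 * (k + 1)) + 1 := by ring_nf
      _ ≤ n ^ ((p + 1) * k * (d - 1) + 2 * k + 5 * (k + 1) + 1) := by
        have := Nat.one_le_pow ((p + 1) * k * (d - 1) + 2 * k + 5 * (k + 1)) n hn1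
        rw [pow_succ]; nlinarith
      -- Origin of `p + 14`: the terms outside `(p + 1) k (d - 1)` sum to `7 k + 6 ≤ 13 k`, as `k ≥
      -- 1`.
      _ ≤ n ^ ((p + 14) * k * d) := by
        refine Nat.pow_le_pow_right hn1 ?_
        obtain ⟨e, rfl⟩ : ∃ e, d = e + 1 := ⟨d - 1, by omega⟩
        have : e + 1 - 1 = e := by omega
        rw [this]
        nlinarith [Nat.zero_le (p * k), Nat.zero_le (k * e)]
  have h5 : (n : ℝ) ^ ((p + 14) * k * d) ≤ Real.exp M := by
    have hn0 : (0 : ℝ) < n := by exact_mod_cast hn1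
    rw [← Real.exp_log (pow_pos hn0 _), Real.log_pow]
    refine Real.exp_le_exp.2 (le_trans (le_of_eq ?_) hM)
    push_cast; ring
  calc _ ≤ (n : ℝ) ^ ((p + 14) * k * d) := by exact_mod_cast h4
    _ ≤ Real.exp M := h5
    _ ≤ Real.exp (2 * M) :=
      Real.exp_le_exp.2 (by linarith [(Nat.cast_nonneg M : (0 : ℝ) ≤ M)])

end Counting

/-! ### Assembly of the lemma. -/

/-- The first part of the multiplier lemma, for an explicit choice of the constants. -/
theorem one_sub_exp_le_measureReal_multiplierBound {Ω : Type*} [MeasurableSpace Ω]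
    {μ : Measure Ω} [IsProbabilityMeasure μ] {p k n d m M b : ℕ} (hb : 1 ≤ b)
    {B : Fin M → Finset (Fin m)} (hB : IsBatchPartition b B)
    (hM : ((p : ℝ) + 14) * (k * d * Real.log n) ≤ M)
    {G : EuclideanSpace ℝ (Fin k) → EuclideanSpace ℝ (Fin n)}
    (hG : IsReLUNetwork (n ^ p) d k n G) (zstar : EuclideanSpace ℝ (Fin k)) {C σ t : ℝ}
    {A : Ω → Matrix (Fin m) (Fin n) ℝ} {η y : Ω → Fin m → ℝ}
    (hS : IsUncorruptedSample μ C σ (G zstar) A η y) (ht : 0 < t)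
    (hbt : 16 * Real.exp 80 * (σ ^ 2 / t ^ 2) ≤ b) :
    1 - Real.exp (-M) ≤ μ.real {ω | MultiplierBound G zstar b B t (A ω) (η ω)} := by
  have hb0 : (0 : ℝ) < b := by exact_mod_cast hb
  have hM0 : (0 : ℝ) ≤ M := Nat.cast_nonneg M
  rcases Nat.eq_zero_or_pos M with rfl | hMpos
  · simp
  have htriv : (∀ z, G z = G zstar) →
      1 - Real.exp (-M) ≤ μ.real {ω | MultiplierBound G zstar b B t (A ω) (η ω)} := fun h => by
    have huniv : {ω | MultiplierBound G zstar b B t (A ω) (η ω)} = Set.univ :=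
      Set.eq_univ_of_forall fun ω z => ⟨Finset.univ, by simp; nlinarith, fun j _ => by
        rw [abs_multiplier_eq]; simp [h z]⟩
    rw [huniv, probReal_univ]
    linarith [Real.exp_pos (-(M : ℝ))]
  rcases Nat.eq_zero_or_pos k with rfl | hk
  · exact htriv fun z => by rw [Subsingleton.elim z zstar]
  rcases Nat.eq_zero_or_pos n with rfl | hn
  · exact htriv fun z => Subsingleton.elim _ _
  have hst : 16 * Real.exp 80 * (σ ^ 2 / b) ≤ t ^ 2 := by
    have h1 : 16 * Real.exp 80 * (σ ^ 2 / t ^ 2) = 16 * Real.exp 80 * σ ^ 2 / t ^ 2 := by ring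
    rw [h1, div_le_iff₀ (by positivity)] at hbt
    have h2 : 16 * Real.exp 80 * (σ ^ 2 / b) = 16 * Real.exp 80 * σ ^ 2 / b := by ring
    rw [h2, div_le_iff₀ hb0]
    linarith
  obtain ⟨𝓔, r, hr, hcover, hcard⟩ : ∃ (𝓔 : Finset (Submodule ℝ (EuclideanSpace ℝ (Fin n))))
      (r : ℕ), (∀ E ∈ 𝓔, Module.finrank ℝ E ≤ r) ∧ (∀ z, ∃ E ∈ 𝓔, G z - G zstar ∈ E) ∧
        (𝓔.card : ℝ) * (5 * n ^ 2) ^ r + 1 ≤ Real.exp (2 * M) := by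
    -- For `n = 1`, `log n = 0` and `hM` gives no information. The whole line is a single subspace,
    -- and `5 + 1 ≤ exp 2 ≤ exp (2 M)` because `M ≥ 1`.
    rcases Nat.lt_or_ge n 2 with hn2 | hn2
    · obtain rfl : n = 1 := by omega
      refine ⟨{⊤}, 1, by simp, fun z => ⟨⊤, by simp⟩, ?_⟩
      have hM1 : (1 : ℝ) ≤ M := by exact_mod_cast hMpos
      calc _ ≤ (2.7 : ℝ) ^ 2 := by norm_num
        _ ≤ Real.exp 1 ^ 2 := by
          have := Real.exp_one_gt_d9
          gcongr
          linarith
        _ = Real.exp 2 := by rw [← Real.exp_nat_mul]; norm_num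
        _ ≤ Real.exp (2 * M) := Real.exp_le_exp.2 (by linarith)
    · obtain ⟨𝓔, hcard, hr, hcover⟩ := hG.isPiecewiseAffine.exists_submodules (G zstar)
      have hd : 1 ≤ d := by
        obtain ⟨h, -, -, -, -, rfl, -⟩ := hG
        omega
      refine ⟨𝓔, k + 1, hr, hcover, le_trans ?_ (pieces_mul_net_le_exp hk hd hn2 hM)⟩
      gcongr
  have hmain := one_sub_exp_le_measureReal_uniform_majority (μ := μ) hn
    (hS.iIndepFun_batchMean b hB.disjoint) ht
    (fun j v => hS.integrable_inner_batchMean_sq b (B j) v)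
    (fun j v => hS.integral_inner_batchMean_sq_le hb (hB.card_eq j) v) hst 𝓔 hr hcard
  refine hmain.trans (measureReal_mono fun ω hω z => ?_)
  obtain ⟨E, hE, hz⟩ := hcover z
  obtain ⟨J, hJ, hbound⟩ := hω E hE _ hz
  exact ⟨J, hJ, fun j hj => by rw [abs_multiplier_eq]; exact hbound j hj⟩

lemma IsBatchPartition.mul_eq {m M b : ℕ} {B : Fin M → Finset (Fin m)}
    (hB : IsBatchPartition b B) : M * b = m := by
  have h1 : (Finset.univ.biUnion B) = Finset.univ :=
    Finset.eq_univ_of_forall fun i => Finset.mem_biUnion.2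
      ((hB.cover i).imp fun j hj => ⟨Finset.mem_univ _, hj⟩)
  have h2 := Finset.card_biUnion (s := Finset.univ) (t := B) fun i _ j _ hij => hB.disjoint hij
  rw [h1] at h2
  simpa [hB.card_eq] using h2.symm

end MultiplierLemma

theorem mainTheorem4 :
    ∃ b₀ > (0 : ℝ), ∃ c > (0 : ℝ), ∀ p : ℕ, ∃ K > (0 : ℝ),
      ∀ (k n d m M b : ℕ) (_hb : 1 ≤ b) (B : Fin M → Finset (Fin m))
        (_hB : MultiplierLemma.IsBatchPartition b B)
        (_hM : K * ((k : ℝ) * (d : ℝ) * Real.log (n : ℝ)) ≤ (M : ℝ))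
        (G : EuclideanSpace ℝ (Fin k) → EuclideanSpace ℝ (Fin n))
        (_hG : MultiplierLemma.IsReLUNetwork (n ^ p) d k n G)
        (zstar : EuclideanSpace ℝ (Fin k)) (C σ : ℝ) (_hC : 0 < C) (_hσ : 0 ≤ σ)
        (Ω : Type*) (_ : MeasurableSpace Ω) (μ : Measure Ω) (_ : IsProbabilityMeasure μ)
        (A : Ω → Matrix (Fin m) (Fin n) ℝ) (η y : Ω → Fin m → ℝ)
        (_hS : MultiplierLemma.IsUncorruptedSample μ C σ (G zstar) A η y),
        (∀ t : ℝ, 0 < t → b₀ * (σ ^ 2 / t ^ 2) ≤ (b : ℝ) →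
          1 - Real.exp (-(c / (b : ℝ)) * (m : ℝ)) ≤
            μ.real {ω | MultiplierLemma.MultiplierBound G zstar b B t (A ω) (η ω)}) ∧
        (b₀ ≤ (b : ℝ) →
          1 - Real.exp (-(c / (b : ℝ)) * (m : ℝ)) ≤
            μ.real {ω | MultiplierLemma.MultiplierBound G zstar b B σ (A ω) (η ω)}) := by
  -- `c = 1` because `m / b = M`, and the failure probability obtained is `exp (-M)`.
  refine ⟨16 * Real.exp 80, by positivity, 1, one_pos, fun p => ⟨p + 14, by positivity, ?_⟩⟩
  intro k n d m M b hb B hB hM G hG zstar C σ _ hσ Ω _ μ _ A η y hS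
  have hb0 : (b : ℝ) ≠ 0 := by exact_mod_cast (by omega : b ≠ 0)
  have hm : -(1 / (b : ℝ)) * (m : ℝ) = -M := by
    rw [← hB.mul_eq, Nat.cast_mul]
    field_simp
  rw [hm]
  refine ⟨fun t ht hbt => MultiplierLemma.one_sub_exp_le_measureReal_multiplierBound
    hb hB hM hG zstar hS ht hbt, fun hbb => ?_⟩
  -- The second part is the first with `t = σ`, except that `σ = 0` is not an admissible `t`; there
  -- the noise vanishes almost surely.
  rcases hσ.eq_or_lt with rfl | hσ0
  · rw [hS.measureReal_multiplierBound_of_sigma_eq_zero]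
    linarith [Real.exp_pos (-(M : ℝ))]
  · refine MultiplierLemma.one_sub_exp_le_measureReal_multiplierBound hb hB hM hG zstar hS hσ0 ?_
    rwa [div_self (pow_ne_zero 2 hσ0.ne'), mul_one]
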